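/- Let $E_d, A_d \in \mathbb{R}^{n_d\times n_d}$, $B_d\in\mathbb{R}^{n_d\times n_u}$, $K_d\in\mathbb{R}^{n_u\times n_d}$, $G_d\in\mathbb{R}^{n_d\times n_{fd}}$, $A_a\in\mathbb{R}^{n_a\times n_a}$, $G_a\in\mathbb{R}^{n_a\times n_{fa}}$, let $f_d:\mathbb{R}^{n_d}\times\mathbb{R}^{n_a}\to\mathbb{R}^{n_{fd}}$ and $f_a:\mathbb{R}^{n_d}\times\mathbb{R}^{n_a}\to\mathbb{R}^{n_{fa}}$, and let $\mathcal{X}_d\subseteq\mathbb{R}^{n_d}$, $\mathcal{X}_a\subseteq\mathbb{R}^{n_a}$ be the operating regions. Consider the closed-loop semi-explicit nonlinear differential-algebraic system $$E_d\dot x_d=(A_d+B_dK_d)x_d+G_df_d(x_d,x_a),\qquad 0=A_ax_a+G_af_a(x_d,x_a),$$ whose trajectories are understood to satisfy $x_d(t)\in\mathcal{X}_d$ and $x_a(t)\in\mathcal{X}_a$. Assume the following. 1. $f_d$ and $f_a$ are smooth, $f_d(0,0)=0$ and $f_a(0,0)=0$, and for given matrices $H_d^d,H_a^d,H_d^a,H_a^a$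 and all $x_d\in\mathcal{X}_d$, $x_a\in\mathcal{X}_a$, $$\|f_d(x_d,x_a)\|_2^2\le\|H_d^dx_d\|_2^2+\|H_a^dx_a\|_2^2,\qquad \|f_a(x_d,x_a)\|_2^2\le\|H_d^ax_d\|_2^2+\|H_a^ax_a\|_2^2 .$$ 2. (Index one.) $\operatorname{rank}\bigl(A_a+G_a\,\tfrac{\partial f_a}{\partial x_a}(x_d,x_a)\bigr)=n_a$ for all $x_d\in\mathcal{X}_d$, $x_a\in\mathcal{X}_a$. Put $\bar H_d:=H_d^{d\top}H_d^d+H_d^{a\top}H_d^a$ and $\bar H_a:=H_a^{d\top}H_a^d+H_a^{a\top}H_a^a$. Suppose that there exist nonsingular matrices $Q_1\in\mathbb{R}^{n_d\times n_d}$ and $Q_3\in\mathbb{R}^{n_a\times n_a}$, a matrix $Q_2\in\mathbb{R}^{n_a\times n_d}$ and a scalar $\bar\epsilon>0$ such that $$\begin{bmatrix}\Upsilon&*&*&*\\ A_aQ_2&Q_3^\top A_a^\top+A_aQ_3+\bar\epsilon G_aG_a^\top&*&*\\ \bar H_d^{1/2}Q_1&0&-\bar\epsilon I&*\\ \bar H_a^{1/2}Q_2&\bar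 H_a^{1/2}Q_3&0&-\bar\epsilon I\end{bmatrix}\prec0,\qquad E_d^\top Q_1^{-1}=Q_1^{-\top}E_d\succ0,$$ where $*$ denotes the blocks determined by symmetry and $$\Upsilon:=Q_1^\top A_d^\top+A_dQ_1+Q_1^\top K_d^\top B_d^\top+B_dK_dQ_1+\bar\epsilon G_dG_d^\top .$$ Then the closed-loop system is asymptotically stable around the origin: $\|x_d(t)\|_2\to0$ and $\|x_a(t)\|_2\to0$ as $t\to\infty$ along every trajectory on $[t_0,\infty)$, for every $t_0\in\mathbb{R}$. Moreover the decay is exponential: there are constants $\psi,\varrho,\gamma>0$, the same for all trajectories and all initial times $t_0$, such that $$\|x_d(t)\|_2\le\psi e^{-\gamma(t-t_0)}\|x_d(t_0)\|_2,\qquad \|x_a(t)\|_2\le\varrho e^{-\gamma(t-t_0)}\|x_d(t_0)\|_2$$ for all $t$ in the interval of existence (bounded or unbounded, starting at $t_0$) of the trajectory. -/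

import Mathlib

open Set Filter Topology
open scoped Matrix MatrixOrder ContDiff

noncomputable section

/-- Data of a closed-loop semi-explicit nonlinear differential-algebraic system
`E_d ẋ_d = (A_d + B_d K_d) x_d + G_d f_d(x_d, x_a)`, `0 = A_a x_a + G_a f_a(x_d, x_a)`,
with the operating regions `X_d`, `X_a` of the dynamic and the algebraic state. The numbers are
the dimensions of `x_d`, `x_a`, of the input, and of the values of `f_d` and `f_a`. -/
structure ClosedLoopNDAE (nd na nu nfd nfa : ℕ) where
  E_d : Matrix (Fin nd) (Fin nd) ℝ
  A_d : Matrix (Fin nd) (Fin nd) ℝ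
  B_d : Matrix (Fin nd) (Fin nu) ℝ
  K_d : Matrix (Fin nu) (Fin nd) ℝ
  G_d : Matrix (Fin nd) (Fin nfd) ℝ
  A_a : Matrix (Fin na) (Fin na) ℝ
  G_a : Matrix (Fin na) (Fin nfa) ℝ
  f_d : EuclideanSpace ℝ (Fin nd) → EuclideanSpace ℝ (Fin na) → EuclideanSpace ℝ (Fin nfd)
  f_a : EuclideanSpace ℝ (Fin nd) → EuclideanSpace ℝ (Fin na) → EuclideanSpace ℝ (Fin nfa)
  X_d : Set (EuclideanSpace ℝ (Fin nd))
  X_a : Set (EuclideanSpace ℝ (Fin na))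

namespace ClosedLoopNDAE

variable {nd na nu nfd nfa : ℕ} (S : ClosedLoopNDAE nd na nu nfd nfa)

/-- The nonlinearities are smooth and vanish at the origin. -/
def SmoothVanishing : Prop :=
  ContDiff ℝ ∞ (fun p : EuclideanSpace ℝ (Fin nd) × EuclideanSpace ℝ (Fin na) => S.f_d p.1 p.2) ∧
  ContDiff ℝ ∞ (fun p : EuclideanSpace ℝ (Fin nd) × EuclideanSpace ℝ (Fin na) => S.f_a p.1 p.2) ∧
  S.f_d 0 0 = 0 ∧ S.f_a 0 0 = 0

/-- The nonlinearities are quadratically bounded on the operating region. The first index of a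
bounding matrix names the state that it multiplies, the second one the nonlinearity. -/
def QuadraticallyBounded {h₁ h₂ h₃ h₄ : ℕ}
    (Hdd : Matrix (Fin h₁) (Fin nd) ℝ) (Had : Matrix (Fin h₂) (Fin na) ℝ)
    (Hda : Matrix (Fin h₃) (Fin nd) ℝ) (Haa : Matrix (Fin h₄) (Fin na) ℝ) : Prop :=
  ∀ xd ∈ S.X_d, ∀ xa ∈ S.X_a,
    ‖S.f_d xd xa‖ ^ 2 ≤ ‖Hdd.toEuclideanLin xd‖ ^ 2 + ‖Had.toEuclideanLin xa‖ ^ 2 ∧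
    ‖S.f_a xd xa‖ ^ 2 ≤ ‖Hda.toEuclideanLin xd‖ ^ 2 + ‖Haa.toEuclideanLin xa‖ ^ 2

/-- The partial Jacobian matrix `∂f_a/∂x_a` at `(xd, xa)`. -/
def jacobian_fa (xd : EuclideanSpace ℝ (Fin nd)) (xa : EuclideanSpace ℝ (Fin na)) :
    Matrix (Fin nfa) (Fin na) ℝ :=
  Matrix.of fun i j => fderiv ℝ (fun y => S.f_a xd y) xa (EuclideanSpace.single j 1) i

/-- The index-one condition: the Jacobian of the algebraic equation with respect to `x_a` has full
rank on the operating region. -/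
def IndexOne : Prop :=
  ∀ xd ∈ S.X_d, ∀ xa ∈ S.X_a, (S.A_a + S.G_a * S.jacobian_fa xd xa).rank = na

/-- `(xd, xa)` is a trajectory of the system, inside the operating region, on the interval `I`. -/
structure IsSolutionOn (I : Set ℝ) (xd : ℝ → EuclideanSpace ℝ (Fin nd))
    (xa : ℝ → EuclideanSpace ℝ (Fin na)) : Prop where
  mem_region : ∀ t ∈ I, xd t ∈ S.X_d ∧ xa t ∈ S.X_a
  differential : ∀ t ∈ I, ∃ v : EuclideanSpace ℝ (Fin nd), HasDerivWithinAt xd v I t ∧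
    S.E_d.toEuclideanLin v = (S.A_d + S.B_d * S.K_d).toEuclideanLin (xd t)
      + S.G_d.toEuclideanLin (S.f_d (xd t) (xa t))
  algebraic : ∀ t ∈ I,
    0 = S.A_a.toEuclideanLin (xa t) + S.G_a.toEuclideanLin (S.f_a (xd t) (xa t))

/-- Asymptotic stability: along every trajectory on `[t₀, ∞)` both states tend to zero. -/
def AsymptoticallyStable : Prop :=
  ∀ (t₀ : ℝ) (xd : ℝ → EuclideanSpace ℝ (Fin nd)) (xa : ℝ → EuclideanSpace ℝ (Fin na)),
    S.IsSolutionOn (Ici t₀) xd xa →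
      Tendsto (fun t => ‖xd t‖) atTop (𝓝 0) ∧ Tendsto (fun t => ‖xa t‖) atTop (𝓝 0)

/-- Exponential decay of both states, with constants that serve all initial times and all
trajectories, for as long as the trajectory exists (on any interval `I` that starts at `t₀`,
bounded or not). -/
def ExponentialDecay : Prop :=
  ∃ ψ > (0 : ℝ), ∃ ρ > (0 : ℝ), ∃ γ > (0 : ℝ),
    ∀ (t₀ : ℝ) (I : Set ℝ), I.OrdConnected → IsLeast I t₀ →
    ∀ (xd : ℝ → EuclideanSpace ℝ (Fin nd)) (xa : ℝ → EuclideanSpace ℝ (Fin na)),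
      S.IsSolutionOn I xd xa → ∀ t ∈ I,
        ‖xd t‖ ≤ ψ * Real.exp (-γ * (t - t₀)) * ‖xd t₀‖ ∧
        ‖xa t‖ ≤ ρ * Real.exp (-γ * (t - t₀)) * ‖xd t₀‖

/-- The block `Υ`, which contains the bilinear term `K_d Q₁`. -/
def upsilon (Q₁ : Matrix (Fin nd) (Fin nd) ℝ) (ε : ℝ) : Matrix (Fin nd) (Fin nd) ℝ :=
  Q₁ᵀ * S.A_dᵀ + S.A_d * Q₁ + Q₁ᵀ * S.K_dᵀ * S.B_dᵀ + S.B_d * S.K_d * Q₁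
    + ε • (S.G_d * S.G_dᵀ)

/-- The symmetric `4 × 4` block matrix of the matrix inequality, grouped as a `2 × 2` block matrix
of `2 × 2` block matrices; `Hd` and `Ha` are the weights `H̄_d`, `H̄_a`, and `CFC.sqrt` is the
positive semidefinite square root. -/
def stabilizationMatrix (Hd : Matrix (Fin nd) (Fin nd) ℝ) (Ha : Matrix (Fin na) (Fin na) ℝ)
    (Q₁ : Matrix (Fin nd) (Fin nd) ℝ) (Q₂ : Matrix (Fin na) (Fin nd) ℝ)
    (Q₃ : Matrix (Fin na) (Fin na) ℝ) (ε : ℝ) :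
    Matrix ((Fin nd ⊕ Fin na) ⊕ (Fin nd ⊕ Fin na)) ((Fin nd ⊕ Fin na) ⊕ (Fin nd ⊕ Fin na)) ℝ :=
  let M₁₁ := Matrix.fromBlocks
    (S.upsilon Q₁ ε) (S.A_a * Q₂)ᵀ
    (S.A_a * Q₂)     (Q₃ᵀ * S.A_aᵀ + S.A_a * Q₃ + ε • (S.G_a * S.G_aᵀ))
  let M₂₁ := Matrix.fromBlocks
    (CFC.sqrt Hd * Q₁) 0
    (CFC.sqrt Ha * Q₂) (CFC.sqrt Ha * Q₃)
  Matrix.fromBlocks M₁₁ M₂₁ᵀ M₂₁ (-(ε • 1))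

/-- Feasibility of the nonconvex matrix inequality: `Q₁`, `Q₃` nonsingular, `ε > 0`, the block
matrix negative definite, and `E_dᵀ Q₁⁻¹ = Q₁⁻ᵀ E_d ≻ 0`. -/
def StabilizationFeasible (Hd : Matrix (Fin nd) (Fin nd) ℝ) (Ha : Matrix (Fin na) (Fin na) ℝ) :
    Prop :=
  ∃ (Q₁ : Matrix (Fin nd) (Fin nd) ℝ) (Q₂ : Matrix (Fin na) (Fin nd) ℝ)
    (Q₃ : Matrix (Fin na) (Fin na) ℝ) (ε : ℝ),
    IsUnit Q₁ ∧ IsUnit Q₃ ∧ 0 < ε ∧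
    (-(S.stabilizationMatrix Hd Ha Q₁ Q₂ Q₃ ε)).PosDef ∧
    S.E_dᵀ * Q₁⁻¹ = (Q₁⁻¹)ᵀ * S.E_d ∧ (S.E_dᵀ * Q₁⁻¹).PosDef

end ClosedLoopNDAE

end

/-! This is a Lyapunov argument with `V x = x ⬝ᵥ (E_dᵀ Q₁⁻¹ x)`. In the coordinates `x_d = Q₁ y₁`,
`x_a = Q₂ y₁ + Q₃ y₂`, the Schur complement of the matrix inequality is a quadratic form in `(y₁,
y₂)`. Young's inequality turns its negativity into the dissipation estimate `exists_dissipation`.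
Along a trajectory `V' = 2 y₁ ⬝ᵥ (E_d ẋ_d)`, and the algebraic equation, paired with `y₂`,
contributes zero. The growth bounds on `f_d`, `f_a` cancel the `ε⁻¹` terms, so `V' ≤ -c |y₁|²`,
which is at most a negative multiple of `V`; this gives `exists_differential_decay`. The same
estimate with `y₁ = 0` shows that the algebraic equation forces `‖x_a‖ ≤ C ‖x_d‖`
(`exists_algebraic_bound`), so `x_a` inherits the decay of `x_d`. -/

namespace Matrix

/-! ### Quadratic forms of real matrices. -/

variable {m n : Type*} [Fintype m] [Fintype n]

theorem dotProduct_mulVec_transpose (M : Matrix m n ℝ) (x : n → ℝ) (y : m → ℝ) :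
    x ⬝ᵥ (Mᵀ *ᵥ y) = (M *ᵥ x) ⬝ᵥ y := by
  rw [dotProduct_mulVec, vecMul_transpose]

theorem dotProduct_gram_mulVec (M : Matrix m n ℝ) (x : n → ℝ) :
    x ⬝ᵥ ((Mᵀ * M) *ᵥ x) = (M *ᵥ x) ⬝ᵥ (M *ᵥ x) := by
  rw [← mulVec_mulVec, dotProduct_mulVec_transpose]

theorem dotProduct_gram_add_gram_mulVec {k : Type*} [Fintype k] (M : Matrix m n ℝ)
    (N : Matrix k n ℝ) (x : n → ℝ) :
    x ⬝ᵥ ((Mᵀ * M + Nᵀ * N) *ᵥ x) = (M *ᵥ x) ⬝ᵥ (M *ᵥ x) + (N *ᵥ x) ⬝ᵥ (N *ᵥ x) := by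
  rw [add_mulVec, dotProduct_add, dotProduct_gram_mulVec, dotProduct_gram_mulVec]

theorem mulVec_inv_mulVec_of_isUnit [DecidableEq n] {Q : Matrix n n ℝ} (hQ : IsUnit Q)
    (x : n → ℝ) : Q *ᵥ (Q⁻¹ *ᵥ x) = x := by
  rw [mulVec_mulVec, mul_nonsing_inv _ ((isUnit_iff_isUnit_det _).1 hQ), one_mulVec]

theorem dotProduct_self_nonneg_real (x : n → ℝ) : 0 ≤ x ⬝ᵥ x :=
  Finset.sum_nonneg fun i _ => mul_self_nonneg (x i)

/-- Young's inequality, by completing the square in each coordinate. It absorbs the cross terms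
between state and nonlinearity. -/
theorem two_mul_dotProduct_le (x y : n → ℝ) {ε : ℝ} (hε : 0 < ε) :
    2 * (x ⬝ᵥ y) ≤ ε * (x ⬝ᵥ x) + ε⁻¹ * (y ⬝ᵥ y) := by
  simp only [dotProduct, Finset.mul_sum, ← Finset.sum_add_distrib]
  refine Finset.sum_le_sum fun i _ => ?_
  have h : ε * (x i * x i) + ε⁻¹ * (y i * y i) - 2 * (x i * y i)
      = ε⁻¹ * (ε * x i - y i) ^ 2 := by
    field_simp
    ring
  have : 0 ≤ ε⁻¹ * (ε * x i - y i) ^ 2 := by positivity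
  linarith

/-- A matrix acts as a bounded operator for the Euclidean norm. -/
theorem exists_mulVec_dotProduct_self_le (M : Matrix m n ℝ) :
    ∃ C > (0 : ℝ), ∀ x : n → ℝ, (M *ᵥ x) ⬝ᵥ (M *ᵥ x) ≤ C * (x ⬝ᵥ x) := by
  -- The squared Frobenius norm, by Cauchy–Schwarz on each row; the `1` makes the constant strictly
  -- positive.
  refine ⟨1 + ∑ i, M i ⬝ᵥ M i, ?_, fun x => ?_⟩
  · have := Finset.sum_nonneg fun i (_ : i ∈ Finset.univ) => dotProduct_self_nonneg_real (M i)
    linarith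
  · have h : ∀ i, (M *ᵥ x) i * (M *ᵥ x) i ≤ (M i ⬝ᵥ M i) * (x ⬝ᵥ x) := fun i => by
      have := Finset.sum_mul_sq_le_sq_mul_sq Finset.univ (M i) x
      simpa only [mulVec, dotProduct, ← pow_two] using this
    calc (M *ᵥ x) ⬝ᵥ (M *ᵥ x) ≤ ∑ i, (M i ⬝ᵥ M i) * (x ⬝ᵥ x) :=
          Finset.sum_le_sum fun i _ => h i
      _ ≤ _ := by
          rw [← Finset.sum_mul]
          have := dotProduct_self_nonneg_real x
          nlinarith

theorem exists_dotProduct_mulVec_le (M : Matrix n n ℝ) :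
    ∃ C > (0 : ℝ), ∀ x : n → ℝ, x ⬝ᵥ (M *ᵥ x) ≤ C * (x ⬝ᵥ x) := by
  obtain ⟨C, hC, h⟩ := exists_mulVec_dotProduct_self_le M
  refine ⟨(1 + C) / 2, by positivity, fun x => ?_⟩
  have h1 := two_mul_dotProduct_le x (M *ᵥ x) one_pos
  have h2 := h x
  linarith

/-- A positive definite matrix is coercive. -/
theorem PosDef.exists_le_dotProduct_mulVec {M : Matrix n n ℝ} (hM : M.PosDef) :
    ∃ c > (0 : ℝ), ∀ x : n → ℝ, c * (x ⬝ᵥ x) ≤ x ⬝ᵥ (M *ᵥ x) := by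
  classical
  -- With `M = Bᵀ B` and `B` invertible, coercivity of `M` is boundedness of `B⁻¹`.
  obtain ⟨B, hB, rfl⟩ :=
    CStarAlgebra.isStrictlyPositive_iff_eq_star_mul_self.mp hM.isStrictlyPositive
  obtain ⟨C, hC, h⟩ := exists_mulVec_dotProduct_self_le B⁻¹
  refine ⟨C⁻¹, inv_pos.2 hC, fun x => ?_⟩
  have h1 := h (B *ᵥ x)
  rw [mulVec_mulVec, nonsing_inv_mul _ ((isUnit_iff_isUnit_det _).1 hB), one_mulVec] at h1
  rw [star_eq_conjTranspose, conjTranspose_eq_transpose_of_trivial, dotProduct_gram_mulVec,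
    inv_mul_le_iff₀ hC]
  exact h1

theorem dotProduct_sqrt_mulVec [DecidableEq n] {H : Matrix n n ℝ} (hH : H.PosSemidef)
    (x : n → ℝ) : (CFC.sqrt H *ᵥ x) ⬝ᵥ (CFC.sqrt H *ᵥ x) = x ⬝ᵥ (H *ᵥ x) := by
  have h0 : 0 ≤ H := hH.nonneg
  have hs : (CFC.sqrt H)ᵀ = CFC.sqrt H := by
    have := (nonneg_iff_posSemidef.1 (CFC.sqrt_nonneg H)).isHermitian
    rwa [IsHermitian, conjTranspose_eq_transpose_of_trivial] at this
  rw [← dotProduct_gram_mulVec, hs, CFC.sqrt_mul_sqrt_self H h0]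

theorem norm_sq_toEuclideanLin [DecidableEq n] (M : Matrix m n ℝ) (x : EuclideanSpace ℝ n) :
    ‖M.toEuclideanLin x‖ ^ 2 = (M *ᵥ x.ofLp) ⬝ᵥ (M *ᵥ x.ofLp) := by
  rw [EuclideanSpace.real_norm_sq_eq]
  simp [dotProduct, pow_two]

theorem norm_sq_eq_dotProduct (x : EuclideanSpace ℝ n) : ‖x‖ ^ 2 = x.ofLp ⬝ᵥ x.ofLp := by
  rw [EuclideanSpace.real_norm_sq_eq]
  simp [dotProduct, pow_two]

theorem posSemidef_gram_add_gram {k : Type*} [Fintype k] (M : Matrix m n ℝ) (N : Matrix k n ℝ) :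
    (Mᵀ * M + Nᵀ * N).PosSemidef := by
  have h1 := posSemidef_conjTranspose_mul_self M
  have h2 := posSemidef_conjTranspose_mul_self N
  simp only [conjTranspose_eq_transpose_of_trivial] at h1 h2
  exact h1.add h2

end Matrix

/-! ### A Grönwall-type estimate. -/

open Matrix

/-- A nonnegative energy that satisfies `w' ≤ -k w` decays exponentially. -/
theorem le_exp_mul_of_hasDerivWithinAt_le {I : Set ℝ} (hI : I.OrdConnected) {t₀ : ℝ}
    (ht₀ : IsLeast I t₀) {w w' : ℝ → ℝ} {k : ℝ} (hw : ∀ t ∈ I, HasDerivWithinAt w (w' t) I t)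
    (hle : ∀ t ∈ I, w' t ≤ -k * w t) {t : ℝ} (ht : t ∈ I) :
    w t ≤ Real.exp (-k * (t - t₀)) * w t₀ := by
  have hsub : Icc t₀ t ⊆ I := hI.out ht₀.1 ht
  have hg : ∀ s ∈ I, HasDerivWithinAt (fun s => Real.exp (k * (s - t₀)) * w s)
      (Real.exp (k * (s - t₀)) * k * w s + Real.exp (k * (s - t₀)) * w' s) I s := fun s hs => by
    have he : HasDerivAt (fun s => Real.exp (k * (s - t₀))) (Real.exp (k * (s - t₀)) * k) s := by
      simpa using (((hasDerivAt_id s).sub_const t₀).const_mul k).exp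
    exact he.hasDerivWithinAt.mul (hw s hs)
  -- The integrating factor `exp (k (s - t₀))` makes the product nonincreasing.
  have hanti : AntitoneOn (fun s => Real.exp (k * (s - t₀)) * w s) (Icc t₀ t) := by
    refine antitoneOn_of_hasDerivWithinAt_nonpos (convex_Icc t₀ t)
      (fun s hs => ((hg s (hsub hs)).continuousWithinAt.mono hsub))
      (fun s hs => (hg s (hsub (interior_subset hs))).mono (interior_subset.trans hsub))
      fun s hs => ?_
    have h1 := hle s (hsub (interior_subset hs))
    have h2 := Real.exp_pos (k * (s - t₀))
    nlinarith
  have hle' := ht₀.2 ht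
  have h := hanti (left_mem_Icc.2 hle') (right_mem_Icc.2 hle') hle'
  simp only [sub_self, mul_zero, Real.exp_zero, one_mul] at h
  rw [neg_mul, Real.exp_neg, ← div_eq_inv_mul, le_div_iff₀ (Real.exp_pos _), mul_comm]
  exact h

/-! ### From the matrix inequality to dissipation. -/

namespace ClosedLoopNDAE

variable {nd na nu nfd nfa : ℕ} (S : ClosedLoopNDAE nd na nu nfd nfa)

theorem dotProduct_upsilon_mulVec (Q₁ : Matrix (Fin nd) (Fin nd) ℝ) (ε : ℝ) (y : Fin nd → ℝ) :
    y ⬝ᵥ (S.upsilon Q₁ ε *ᵥ y) =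
      2 * (y ⬝ᵥ ((S.A_d + S.B_d * S.K_d) *ᵥ (Q₁ *ᵥ y)))
        + ε * ((S.G_dᵀ *ᵥ y) ⬝ᵥ (S.G_dᵀ *ᵥ y)) := by
  have h : S.upsilon Q₁ ε = ((S.A_d + S.B_d * S.K_d) * Q₁)ᵀ + (S.A_d + S.B_d * S.K_d) * Q₁
      + ε • (S.G_dᵀᵀ * S.G_dᵀ) := by
    simp only [upsilon, transpose_mul, transpose_add, transpose_transpose, add_mul,
      Matrix.mul_assoc]
    abel
  rw [h, add_mulVec, add_mulVec, smul_mulVec, dotProduct_add, dotProduct_add, dotProduct_smul,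
    dotProduct_gram_mulVec, dotProduct_mulVec_transpose, ← mulVec_mulVec, dotProduct_comm _ y,
    smul_eq_mul]
  ring

/-- The value of the form of the matrix inequality on `(y, ε⁻¹ M₂₁ y)`, that is, the form of its
Schur complement. -/
theorem dotProduct_stabilizationMatrix_mulVec {Hd : Matrix (Fin nd) (Fin nd) ℝ}
    {Ha : Matrix (Fin na) (Fin na) ℝ} (hHd : Hd.PosSemidef) (hHa : Ha.PosSemidef)
    (Q₁ : Matrix (Fin nd) (Fin nd) ℝ) (Q₂ : Matrix (Fin na) (Fin nd) ℝ)
    (Q₃ : Matrix (Fin na) (Fin na) ℝ) {ε : ℝ} (hε : 0 < ε) (y₁ : Fin nd → ℝ) (y₂ : Fin na → ℝ)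
    {xd : Fin nd → ℝ} {xa : Fin na → ℝ} (hxd : xd = Q₁ *ᵥ y₁) (hxa : xa = Q₂ *ᵥ y₁ + Q₃ *ᵥ y₂) :
    let z := Sum.elim (Sum.elim y₁ y₂)
      (Sum.elim (ε⁻¹ • (CFC.sqrt Hd *ᵥ xd)) (ε⁻¹ • (CFC.sqrt Ha *ᵥ xa)))
    z ⬝ᵥ (S.stabilizationMatrix Hd Ha Q₁ Q₂ Q₃ ε *ᵥ z) =
      2 * (y₁ ⬝ᵥ ((S.A_d + S.B_d * S.K_d) *ᵥ xd)) + ε * ((S.G_dᵀ *ᵥ y₁) ⬝ᵥ (S.G_dᵀ *ᵥ y₁))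
      + 2 * (y₂ ⬝ᵥ (S.A_a *ᵥ xa)) + ε * ((S.G_aᵀ *ᵥ y₂) ⬝ᵥ (S.G_aᵀ *ᵥ y₂))
      + ε⁻¹ * (xd ⬝ᵥ (Hd *ᵥ xd) + xa ⬝ᵥ (Ha *ᵥ xa)) := by
  intro z
  have e22 : y₂ ⬝ᵥ ((Q₃ᵀ * S.A_aᵀ + S.A_a * Q₃ + ε • (S.G_a * S.G_aᵀ)) *ᵥ y₂) =
      2 * (y₂ ⬝ᵥ (S.A_a *ᵥ (Q₃ *ᵥ y₂))) + ε * ((S.G_aᵀ *ᵥ y₂) ⬝ᵥ (S.G_aᵀ *ᵥ y₂)) := by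
    have h : Q₃ᵀ * S.A_aᵀ + S.A_a * Q₃ + ε • (S.G_a * S.G_aᵀ)
        = (S.A_a * Q₃)ᵀ + S.A_a * Q₃ + ε • (S.G_aᵀᵀ * S.G_aᵀ) := by
      rw [transpose_mul, transpose_transpose]
    rw [h, add_mulVec, add_mulVec, smul_mulVec, dotProduct_add, dotProduct_add, dotProduct_smul,
      dotProduct_gram_mulVec, dotProduct_mulVec_transpose, ← mulVec_mulVec, dotProduct_comm _ y₂,
      smul_eq_mul]
    ring
  have hd : (CFC.sqrt Hd * Q₁) *ᵥ y₁ = CFC.sqrt Hd *ᵥ xd := by rw [← mulVec_mulVec, hxd]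
  have ha : (CFC.sqrt Ha * Q₂) *ᵥ y₁ + (CFC.sqrt Ha * Q₃) *ᵥ y₂ = CFC.sqrt Ha *ᵥ xa := by
    rw [← mulVec_mulVec, ← mulVec_mulVec, ← mulVec_add, hxa]
  -- The off-diagonal blocks give `2 ε⁻¹ |M₂₁ y|²` and the corner `-ε` gives `-ε⁻¹ |M₂₁ y|²`, so
  -- `ε⁻¹ |M₂₁ y|²` remains.
  have hsplit : z ⬝ᵥ (S.stabilizationMatrix Hd Ha Q₁ Q₂ Q₃ ε *ᵥ z) =
      Sum.elim y₁ y₂ ⬝ᵥ (Matrix.fromBlocks (S.upsilon Q₁ ε) (S.A_a * Q₂)ᵀ (S.A_a * Q₂)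
        (Q₃ᵀ * S.A_aᵀ + S.A_a * Q₃ + ε • (S.G_a * S.G_aᵀ)) *ᵥ Sum.elim y₁ y₂)
      + ε⁻¹ * ((CFC.sqrt Hd *ᵥ xd) ⬝ᵥ (CFC.sqrt Hd *ᵥ xd)
        + (CFC.sqrt Ha *ᵥ xa) ⬝ᵥ (CFC.sqrt Ha *ᵥ xa)) := by
    have hM : Matrix.fromBlocks (CFC.sqrt Hd * Q₁) 0 (CFC.sqrt Ha * Q₂) (CFC.sqrt Ha * Q₃) *ᵥ
        Sum.elim y₁ y₂ = Sum.elim (CFC.sqrt Hd *ᵥ xd) (CFC.sqrt Ha *ᵥ xa) := by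
      rw [fromBlocks_mulVec]
      simp only [Sum.elim_comp_inl, Sum.elim_comp_inr, zero_mulVec, add_zero, hd, ha]
    have hz : z = Sum.elim (Sum.elim y₁ y₂)
        (ε⁻¹ • Sum.elim (CFC.sqrt Hd *ᵥ xd) (CFC.sqrt Ha *ᵥ xa)) := by
      ext i
      rcases i with i | i | i <;> rfl
    rw [hz, stabilizationMatrix, fromBlocks_mulVec]
    simp only [Sum.elim_comp_inl, Sum.elim_comp_inr, sumElim_dotProduct_sumElim, dotProduct_add,
      dotProduct_mulVec_transpose, hM, neg_mulVec, smul_mulVec, one_mulVec, dotProduct_smul,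
      smul_dotProduct, dotProduct_neg, smul_eq_mul]
    field_simp
    ring
  rw [hsplit, fromBlocks_mulVec, dotProduct_sqrt_mulVec hHd, dotProduct_sqrt_mulVec hHa]
  simp only [Sum.elim_comp_inl, Sum.elim_comp_inr, sumElim_dotProduct_sumElim, dotProduct_add,
    dotProduct_mulVec_transpose, e22, dotProduct_upsilon_mulVec]
  have hAa : y₂ ⬝ᵥ (S.A_a *ᵥ xa) =
      y₂ ⬝ᵥ (S.A_a *ᵥ (Q₂ *ᵥ y₁)) + y₂ ⬝ᵥ (S.A_a *ᵥ (Q₃ *ᵥ y₂)) := by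
    rw [hxa, mulVec_add, dotProduct_add]
  rw [← mulVec_mulVec, dotProduct_comm _ y₂, hAa, ← hxd]
  ring

/-- The dissipation estimate that the matrix inequality encodes. -/
theorem exists_dissipation {Hd : Matrix (Fin nd) (Fin nd) ℝ}
    {Ha : Matrix (Fin na) (Fin na) ℝ} (hHd : Hd.PosSemidef) (hHa : Ha.PosSemidef)
    {Q₁ : Matrix (Fin nd) (Fin nd) ℝ} {Q₂ : Matrix (Fin na) (Fin nd) ℝ}
    {Q₃ : Matrix (Fin na) (Fin na) ℝ} {ε : ℝ} (hε : 0 < ε)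
    (hneg : (-(S.stabilizationMatrix Hd Ha Q₁ Q₂ Q₃ ε)).PosDef) :
    ∃ c > (0 : ℝ), ∀ (y₁ : Fin nd → ℝ) (y₂ : Fin na → ℝ) (xd : Fin nd → ℝ) (xa : Fin na → ℝ)
      (u : Fin nfd → ℝ) (v : Fin nfa → ℝ), xd = Q₁ *ᵥ y₁ → xa = Q₂ *ᵥ y₁ + Q₃ *ᵥ y₂ →
      2 * (y₁ ⬝ᵥ ((S.A_d + S.B_d * S.K_d) *ᵥ xd + S.G_d *ᵥ u))
        + 2 * (y₂ ⬝ᵥ (S.A_a *ᵥ xa + S.G_a *ᵥ v))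
        + ε⁻¹ * (xd ⬝ᵥ (Hd *ᵥ xd) + xa ⬝ᵥ (Ha *ᵥ xa))
      ≤ ε⁻¹ * (u ⬝ᵥ u + v ⬝ᵥ v) - c * (y₁ ⬝ᵥ y₁ + y₂ ⬝ᵥ y₂) := by
  obtain ⟨c, hc, h⟩ := hneg.exists_le_dotProduct_mulVec
  refine ⟨c, hc, fun y₁ y₂ xd xa u v hxd hxa => ?_⟩
  have e := S.dotProduct_stabilizationMatrix_mulVec hHd hHa Q₁ Q₂ Q₃ hε y₁ y₂ hxd hxa
  set w := Sum.elim (ε⁻¹ • (CFC.sqrt Hd *ᵥ xd)) (ε⁻¹ • (CFC.sqrt Ha *ᵥ xa))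
  have h1 := h (Sum.elim (Sum.elim y₁ y₂) w)
  simp only at e
  rw [neg_mulVec, dotProduct_neg, e, sumElim_dotProduct_sumElim, sumElim_dotProduct_sumElim] at h1
  -- The weight `ε` reproduces exactly the `ε G Gᵀ` terms on the diagonal of the matrix.
  have hu := two_mul_dotProduct_le (S.G_dᵀ *ᵥ y₁) u hε
  have hv := two_mul_dotProduct_le (S.G_aᵀ *ᵥ y₂) v hε
  have eu : (S.G_dᵀ *ᵥ y₁) ⬝ᵥ u = y₁ ⬝ᵥ (S.G_d *ᵥ u) := by
    rw [← dotProduct_mulVec_transpose, transpose_transpose]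
  have ev : (S.G_aᵀ *ᵥ y₂) ⬝ᵥ v = y₂ ⬝ᵥ (S.G_a *ᵥ v) := by
    rw [← dotProduct_mulVec_transpose, transpose_transpose]
  rw [eu] at hu
  rw [ev] at hv
  have hw := mul_nonneg hc.le (dotProduct_self_nonneg_real w)
  rw [dotProduct_add, dotProduct_add]
  linarith

/-! ### Estimates on the operating region and along trajectories. -/

variable {S} {h₁ h₂ h₃ h₄ : ℕ}
    {Hdd : Matrix (Fin h₁) (Fin nd) ℝ} {Had : Matrix (Fin h₂) (Fin na) ℝ}
    {Hda : Matrix (Fin h₃) (Fin nd) ℝ} {Haa : Matrix (Fin h₄) (Fin na) ℝ}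

/-- On the operating region the algebraic equation bounds `x_a` by `x_d`. -/
theorem exists_algebraic_bound (hbound : S.QuadraticallyBounded Hdd Had Hda Haa)
    (hfeasible : S.StabilizationFeasible (Hddᵀ * Hdd + Hdaᵀ * Hda) (Hadᵀ * Had + Haaᵀ * Haa)) :
    ∃ C > (0 : ℝ), ∀ xd ∈ S.X_d, ∀ xa ∈ S.X_a,
      0 = S.A_a.toEuclideanLin xa + S.G_a.toEuclideanLin (S.f_a xd xa) →
      ‖xa‖ ≤ C * ‖xd‖ := by
  obtain ⟨Q₁, Q₂, Q₃, ε, -, hQ₃, hε, hneg, -, -⟩ := hfeasible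
  obtain ⟨c, hc, hdis⟩ := S.exists_dissipation (posSemidef_gram_add_gram _ _)
    (posSemidef_gram_add_gram _ _) hε hneg
  obtain ⟨C₁, hC₁, h₁⟩ := exists_mulVec_dotProduct_self_le Hda
  obtain ⟨C₃, hC₃, h₃⟩ := exists_mulVec_dotProduct_self_le Q₃
  refine ⟨√(C₃ * (c⁻¹ * (ε⁻¹ * C₁))), by positivity, fun xd hxd xa hxa halg => ?_⟩
  have hb := (hbound xd hxd xa hxa).2
  rw [norm_sq_toEuclideanLin, norm_sq_toEuclideanLin, norm_sq_eq_dotProduct] at hb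
  have halg' : S.A_a *ᵥ xa.ofLp + S.G_a *ᵥ (S.f_a xd xa).ofLp = 0 :=
    (congrArg WithLp.ofLp halg).symm
  set z := Q₃⁻¹ *ᵥ xa.ofLp with hz
  have hxz : xa.ofLp = Q₃ *ᵥ z := by
    rw [hz, mulVec_inv_mulVec_of_isUnit hQ₃]
  -- Only the algebraic part is kept: the true `x_d` enters solely through the value of `f_a`.
  have h := hdis 0 z 0 xa.ofLp 0 (S.f_a xd xa).ofLp (by simp) (by simpa using hxz)
  rw [halg', dotProduct_gram_add_gram_mulVec, dotProduct_gram_add_gram_mulVec] at h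
  simp only [dotProduct_zero, mul_zero, mulVec_zero, zero_add, add_zero] at h
  have hh := dotProduct_self_nonneg_real (Had *ᵥ xa.ofLp)
  -- The `Haa` term in the bound on `f_a` cancels against the weight on `x_a`; the surplus `Had`
  -- term has a favourable sign.
  have hz2 : c * (z ⬝ᵥ z) ≤ ε⁻¹ * (C₁ * (xd.ofLp ⬝ᵥ xd.ofLp)) := by
    have h4 : ε⁻¹ * ((S.f_a xd xa).ofLp ⬝ᵥ (S.f_a xd xa).ofLp) ≤
        ε⁻¹ * (C₁ * (xd.ofLp ⬝ᵥ xd.ofLp) +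
          ((Had *ᵥ xa.ofLp) ⬝ᵥ (Had *ᵥ xa.ofLp) + (Haa *ᵥ xa.ofLp) ⬝ᵥ (Haa *ᵥ xa.ofLp))) :=
      mul_le_mul_of_nonneg_left (by linarith [h₁ xd.ofLp]) (inv_pos.2 hε).le
    linarith
  have hz3 : z ⬝ᵥ z ≤ c⁻¹ * (ε⁻¹ * (C₁ * (xd.ofLp ⬝ᵥ xd.ofLp))) :=
    (le_inv_mul_iff₀ hc).2 hz2
  refine le_of_sq_le_sq ?_ (by positivity)
  rw [mul_pow, Real.sq_sqrt (by positivity), norm_sq_eq_dotProduct, norm_sq_eq_dotProduct, hxz]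
  calc _ ≤ C₃ * (z ⬝ᵥ z) := h₃ z
    _ ≤ C₃ * (c⁻¹ * (ε⁻¹ * (C₁ * (xd.ofLp ⬝ᵥ xd.ofLp)))) := by gcongr
    _ = _ := by ring

/-- `x_d ↦ x_dᵀ E_dᵀ Q₁⁻¹ x_d` decays exponentially along trajectories. -/
theorem exists_differential_decay (hbound : S.QuadraticallyBounded Hdd Had Hda Haa)
    (hfeasible : S.StabilizationFeasible (Hddᵀ * Hdd + Hdaᵀ * Hda) (Hadᵀ * Had + Haaᵀ * Haa)) :
    ∃ ψ > (0 : ℝ), ∃ γ > (0 : ℝ), ∀ (t₀ : ℝ) (I : Set ℝ), I.OrdConnected → IsLeast I t₀ →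
      ∀ (xd : ℝ → EuclideanSpace ℝ (Fin nd)) (xa : ℝ → EuclideanSpace ℝ (Fin na)),
        S.IsSolutionOn I xd xa → ∀ t ∈ I,
          ‖xd t‖ ≤ ψ * Real.exp (-γ * (t - t₀)) * ‖xd t₀‖ := by
  obtain ⟨Q₁, Q₂, Q₃, ε, hQ₁, hQ₃, hε, hneg, hsymm, hpos⟩ := hfeasible
  obtain ⟨c, hc, hdis⟩ := S.exists_dissipation (posSemidef_gram_add_gram _ _)
    (posSemidef_gram_add_gram _ _) hε hneg
  obtain ⟨a, ha, hlow⟩ := hpos.exists_le_dotProduct_mulVec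
  obtain ⟨b, hb, hup⟩ := exists_dotProduct_mulVec_le (S.E_dᵀ * Q₁⁻¹)
  obtain ⟨q, hq, hQ⟩ := exists_mulVec_dotProduct_self_le Q₁
  -- From `a |x|² ≤ V ≤ b |x|²` and `|x|² ≤ q |y₁|²`, `V` decays at rate `c / (b q)`; the norm,
  -- being of square-root size, decays at half of it.
  refine ⟨√(b / a), by positivity, c / (b * q) / 2, by positivity,
    fun t₀ I hI ht₀ xd xa hsol t ht => ?_⟩
  choose! v hv hEv using hsol.differential
  set V : EuclideanSpace ℝ (Fin nd) → ℝ := fun x => x.ofLp ⬝ᵥ ((S.E_dᵀ * Q₁⁻¹) *ᵥ x.ofLp) with hV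
  have hderiv : ∀ s ∈ I, HasDerivWithinAt (fun s => V (xd s))
      (2 * ((Q₁⁻¹ *ᵥ (xd s).ofLp) ⬝ᵥ (S.E_d *ᵥ (v s).ofLp))) I s := fun s hs => by
    let L := LinearMap.toContinuousLinearMap (S.E_dᵀ * Q₁⁻¹).toEuclideanLin
    have hL : HasDerivWithinAt (fun s => L (xd s)) (L (v s)) I s :=
      L.hasFDerivAt.comp_hasDerivWithinAt s (hv s hs)
    have h := (hv s hs).inner ℝ hL
    have hVL : (fun s => V (xd s)) = fun s => inner ℝ (xd s) (L (xd s)) := by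
      funext s
      simp [hV, L, EuclideanSpace.inner_eq_star_dotProduct, dotProduct_comm]
    rw [hVL]
    refine h.congr_deriv ?_
    have i1 : inner ℝ (v s) (L (xd s)) =
        (v s).ofLp ⬝ᵥ ((S.E_dᵀ * Q₁⁻¹) *ᵥ (xd s).ofLp) := by
      simp [L, EuclideanSpace.inner_eq_star_dotProduct, dotProduct_comm]
    have i2 : inner ℝ (xd s) (L (v s)) =
        (xd s).ofLp ⬝ᵥ ((S.E_dᵀ * Q₁⁻¹) *ᵥ (v s).ofLp) := by
      simp [L, EuclideanSpace.inner_eq_star_dotProduct, dotProduct_comm]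
    -- Symmetry of `E_dᵀ Q₁⁻¹` makes the two terms of the product rule equal.
    rw [i1, i2, hsymm, ← mulVec_mulVec, dotProduct_mulVec_transpose, ← hsymm, ← mulVec_mulVec,
      dotProduct_mulVec_transpose, dotProduct_comm (S.E_d *ᵥ _)]
    ring
  have hdecay : ∀ s ∈ I, 2 * ((Q₁⁻¹ *ᵥ (xd s).ofLp) ⬝ᵥ (S.E_d *ᵥ (v s).ofLp)) ≤
      -(c / (b * q)) * V (xd s) := fun s hs => by
    obtain ⟨hmd, hma⟩ := hsol.mem_region s hs
    obtain ⟨hfd, hfa⟩ := hbound _ hmd _ hma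
    rw [norm_sq_toEuclideanLin, norm_sq_toEuclideanLin, norm_sq_eq_dotProduct] at hfd hfa
    have halg : S.A_a *ᵥ (xa s).ofLp + S.G_a *ᵥ (S.f_a (xd s) (xa s)).ofLp = 0 :=
      (congrArg WithLp.ofLp (hsol.algebraic s hs)).symm
    have hdyn : S.E_d *ᵥ (v s).ofLp = (S.A_d + S.B_d * S.K_d) *ᵥ (xd s).ofLp
        + S.G_d *ᵥ (S.f_d (xd s) (xa s)).ofLp := congrArg WithLp.ofLp (hEv s hs)
    set y₁ := Q₁⁻¹ *ᵥ (xd s).ofLp with hy₁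
    have hx : (xd s).ofLp = Q₁ *ᵥ y₁ := by
      rw [hy₁, mulVec_inv_mulVec_of_isUnit hQ₁]
    set y₂ := Q₃⁻¹ *ᵥ ((xa s).ofLp - Q₂ *ᵥ y₁) with hy₂
    have hxa : (xa s).ofLp = Q₂ *ᵥ y₁ + Q₃ *ᵥ y₂ := by
      rw [hy₂, mulVec_inv_mulVec_of_isUnit hQ₃]
      abel
    have h := hdis y₁ y₂ _ _ (S.f_d (xd s) (xa s)).ofLp (S.f_a (xd s) (xa s)).ofLp hx hxa
    -- The algebraic equation removes the `y₂` pairing, and the dynamics turn the `y₁` pairing into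
    -- the derivative of `V`.
    rw [halg, ← hdyn, dotProduct_gram_add_gram_mulVec, dotProduct_gram_add_gram_mulVec,
      dotProduct_zero] at h
    -- The sum of the two growth bounds is the form of `H̄_d` and `H̄_a`, so all `ε⁻¹` terms cancel.
    have hf := mul_le_mul_of_nonneg_left (add_le_add hfd hfa) (inv_pos.2 hε).le
    have hy := mul_nonneg hc.le (dotProduct_self_nonneg_real y₂)
    have hVy : V (xd s) ≤ b * q * (y₁ ⬝ᵥ y₁) := by
      calc V (xd s) ≤ b * ((xd s).ofLp ⬝ᵥ (xd s).ofLp) := hup _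
        _ ≤ b * (q * (y₁ ⬝ᵥ y₁)) := by
            rw [hx]
            exact mul_le_mul_of_nonneg_left (hQ y₁) hb.le
        _ = _ := by ring
    have hcV : c / (b * q) * V (xd s) ≤ c * (y₁ ⬝ᵥ y₁) := by
      calc c / (b * q) * V (xd s) ≤ c / (b * q) * (b * q * (y₁ ⬝ᵥ y₁)) := by gcongr
        _ = _ := by field_simp
    linarith
  have hexp := le_exp_mul_of_hasDerivWithinAt_le hI ht₀ hderiv hdecay ht
  refine le_of_sq_le_sq ?_ (by positivity)
  rw [mul_pow, mul_pow, Real.sq_sqrt (by positivity), ← Real.exp_nat_mul, norm_sq_eq_dotProduct,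
    norm_sq_eq_dotProduct]
  have e : ((2 : ℕ) : ℝ) * (-(c / (b * q) / 2) * (t - t₀)) = -(c / (b * q)) * (t - t₀) := by
    push_cast
    ring
  rw [e, div_mul_eq_mul_div, div_mul_eq_mul_div, le_div_iff₀ ha]
  calc _ = a * ((xd t).ofLp ⬝ᵥ (xd t).ofLp) := mul_comm _ _
    _ ≤ V (xd t) := hlow _
    _ ≤ _ := hexp
    _ ≤ Real.exp (-(c / (b * q)) * (t - t₀)) * (b * ((xd t₀).ofLp ⬝ᵥ (xd t₀).ofLp)) :=
        mul_le_mul_of_nonneg_left (hup _) (Real.exp_pos _).le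
    _ = _ := by ring

theorem ExponentialDecay.asymptoticallyStable (h : S.ExponentialDecay) :
    S.AsymptoticallyStable := by
  obtain ⟨ψ, -, ρ, -, γ, hγ, h⟩ := h
  intro t₀ xd xa hsol
  have hlim : Tendsto (fun t => Real.exp (-γ * (t - t₀))) atTop (𝓝 0) := by
    refine Real.tendsto_exp_atBot.comp ?_
    exact (tendsto_atTop_add_const_right _ (-t₀) tendsto_id).const_mul_atTop_of_neg (by linarith)
  have hb := h t₀ (Ici t₀) ordConnected_Ici isLeast_Ici xd xa hsol
  have hlim' : ∀ k : ℝ, Tendsto (fun t => k * Real.exp (-γ * (t - t₀)) * ‖xd t₀‖) atTop (𝓝 0) :=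
    fun k => by simpa using (hlim.const_mul k).mul_const ‖xd t₀‖
  constructor
  · exact squeeze_zero' (Eventually.of_forall fun t => norm_nonneg _)
      ((eventually_ge_atTop t₀).mono fun t ht => (hb t ht).1) (hlim' ψ)
  · exact squeeze_zero' (Eventually.of_forall fun t => norm_nonneg _)
      ((eventually_ge_atTop t₀).mono fun t ht => (hb t ht).2) (hlim' ρ)

theorem exponentialDecay (hbound : S.QuadraticallyBounded Hdd Had Hda Haa)
    (hfeasible : S.StabilizationFeasible (Hddᵀ * Hdd + Hdaᵀ * Hda) (Hadᵀ * Had + Haaᵀ * Haa)) :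
    S.ExponentialDecay := by
  obtain ⟨C, hC, halg⟩ := exists_algebraic_bound hbound hfeasible
  obtain ⟨ψ, hψ, γ, hγ, hdec⟩ := exists_differential_decay hbound hfeasible
  refine ⟨ψ, hψ, C * ψ, by positivity, γ, hγ, fun t₀ I hI ht₀ xd xa hsol t ht => ?_⟩
  have h1 := hdec t₀ I hI ht₀ xd xa hsol t ht
  obtain ⟨hd, ha⟩ := hsol.mem_region t ht
  refine ⟨h1, (halg _ hd _ ha (hsol.algebraic t ht)).trans ?_⟩
  calc C * ‖xd t‖ ≤ C * (ψ * Real.exp (-γ * (t - t₀)) * ‖xd t₀‖) := by gcongr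
    _ = _ := by ring

end ClosedLoopNDAE

theorem theorem1 {nd na nu nfd nfa h₁ h₂ h₃ h₄ : ℕ} (S : ClosedLoopNDAE nd na nu nfd nfa)
    (Hdd : Matrix (Fin h₁) (Fin nd) ℝ) (Had : Matrix (Fin h₂) (Fin na) ℝ)
    (Hda : Matrix (Fin h₃) (Fin nd) ℝ) (Haa : Matrix (Fin h₄) (Fin na) ℝ)
    (hsmooth : S.SmoothVanishing)
    (hbound : S.QuadraticallyBounded Hdd Had Hda Haa)
    (hindex : S.IndexOne)
    (hfeasible : S.StabilizationFeasible (Hddᵀ * Hdd + Hdaᵀ * Hda) (Hadᵀ * Had + Haaᵀ * Haa)) :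
    S.AsymptoticallyStable ∧ S.ExponentialDecay := by
  have h := ClosedLoopNDAE.exponentialDecay hbound hfeasible
  exact ⟨h.asymptoticallyStable, h⟩
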